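/- Let $\mathbb{P}\subset\mathbb{R}^{n_{\mathrm p}}$ be compact and convex, let $A,B,C,D$ be real matrix functions depending affinely on $p\in\mathbb{P}$ (of the form $M_0+\sum_{i=1}^{n_{\mathrm p}}p_iM_i$), and let $\mathscr{P}\subseteq\mathbb{P}^{\mathbb{Z}}$ be a set of admissible scheduling trajectories. Assume that slow scheduling transitions are admissible: there is $\delta>0$ such that $q\in\mathscr{P}$ whenever $q\in\mathbb{P}^{\mathbb{Z}}$, $p^1,p^2\in\mathscr{P}$ and $\tau\in\mathbb{Z}_{\ge 0}$ satisfy $q_k=p^1_k$ for $k\le 0$, $\|q_{k+1}-q_k\|_2\le\delta$ for $0\le k<\tau$, and $q_k=p^2_{k-\tau}$ for $k\ge\tau$ (this is the case for $\mathscr{P}=\mathbb{P}^{\mathbb{Z}}$ and for rate-bounded scheduling trajectories). Let $$\mathfrak{B}=\{(u,p,x,y)\mid p\in\mathscr{P},\; x_{k+1}=A(p_k)x_k+B(p_k)u_k,\; y_k=C(p_k)x_k+D(p_k)u_k\ \ \forall k\in\mathbb{Z}\}$$ be the behavior of the LPV state-space representation, where $u_k\in\mathbb{R}^{n_{\mathrm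 u}}$, $x_k\in\mathbb{R}^{n_{\mathrm x}}$, $y_k\in\mathbb{R}^{n_{\mathrm y}}$. Assume that: 1. the representation is state-minimal, i.e. structurally state observable and controllable: its $n_{\mathrm x}$-step observability matrix (block rows $C(p_i)A(p_{i-1})\cdots A(p_0)$, $0\le i<n_{\mathrm x}$) and its $n_{\mathrm x}$-step controllability matrix (block columns $A(p_{n_{\mathrm x}-1})\cdots A(p_{i+1})B(p_i)$, $0\le i<n_{\mathrm x}$) have generic rank $n_{\mathrm x}$ over $(p_0,\dots,p_{n_{\mathrm x}-1})\in\mathbb{P}^{n_{\mathrm x}}$ (equivalently, each attains rank $n_{\mathrm x}$ at some such point); 2. its input-output map admits a shifted-affine realization: there are $n_{\mathrm a},n_{\mathrm b}\ge 1$ and matrix functions $a_i,b_i$, affine in $p$, such that the set of all $(u,p,y)$ with $(u,p,x,y)\in\mathfrak{B}$ for some $x$ equals the set of all $(u,p,y)$ with $p\in\mathscr{P}$ and $$y_k+\sum_{i=1}^{n_{\mathrm a}}a_i(p_{k-i})y_{k-i}=\sum_{i=1}^{n_{\mathrm b}}b_i(p_{k-i})u_{k-i}\quad\forall k\in\mathbb{Z}.$$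 Then $\mathfrak{B}$ is controllable: for all $w^1,w^2\in\mathfrak{B}$ there are $\tau\in\mathbb{Z}_{\ge 0}$ and $w\in\mathfrak{B}$ with $w_k=w^1_k$ for $k\le 0$ and $w_k=w^2_{k-\tau}$ for $k\ge\tau$. Moreover, there is a scheduling-dependent quadratic input-output-to-state stability (IOSS) Lyapunov function $W(x,p)=x^\top P(p)x$, i.e. $P(\mathsf p)\succ0$ for all $\mathsf p\in\mathbb{P}$, there are $\alpha_1,\alpha_2>0$ with $\alpha_1\|x\|_2^2\le W(x,\mathsf p)\le\alpha_2\|x\|_2^2$ for all $x\in\mathbb{R}^{n_{\mathrm x}}$ and $\mathsf p\in\mathbb{P}$, and there are $c_1,c_2>0$ such that, for all $(u,p,x,y)\in\mathfrak{B}$ and all $k\in\mathbb{Z}$, $$W(x_{k+1},p_{k+1})-W(x_k,p_k)\le-\tfrac12\|x_k\|_2^2+c_1\|u_k\|_2^2+c_2\|y_k\|_2^2 .$$ -/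

import Mathlib

open scoped Matrix Topology

namespace LPV

/-- A matrix depending affinely on the scheduling vector:
`M(p) = M₀ + ∑ i, pᵢ Mᵢ`. -/
structure AffineMatrix (m n np : ℕ) where
  const : Matrix (Fin m) (Fin n) ℝ
  coeff : Fin np → Matrix (Fin m) (Fin n) ℝ

/-- The value `M₀ + ∑ i, pᵢ Mᵢ`. -/
def AffineMatrix.eval {m n np : ℕ} (M : AffineMatrix m n np) (p : Fin np → ℝ) :
    Matrix (Fin m) (Fin n) ℝ :=
  M.const + ∑ i, p i • M.coeff i

/-- The data of a state-space representation
`x (k+1) = A(p k) x k + B(p k) u k`, `y k = C(p k) x k + D(p k) u k`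
with affine scheduling dependence. -/
structure StateSpace (nu np nx ny : ℕ) where
  A : AffineMatrix nx nx np
  B : AffineMatrix nx nu np
  C : AffineMatrix ny nx np
  D : AffineMatrix ny nu np

/-- The value at one time instant of a trajectory `(u, p, x, y)`. -/
abbrev Point (nu np nx ny : ℕ) : Type :=
  (Fin nu → ℝ) × (Fin np → ℝ) × (Fin nx → ℝ) × (Fin ny → ℝ)

/-- The value at one time instant of an input-scheduling-output trajectory `(u, p, y)`. -/
abbrev IOPoint (nu np ny : ℕ) : Type :=
  (Fin nu → ℝ) × (Fin np → ℝ) × (Fin ny → ℝ)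

/-- The set `P^ℤ` of all scheduling trajectories with values in `P`. -/
def valuedIn {np : ℕ} (P : Set (Fin np → ℝ)) : Set (ℤ → Fin np → ℝ) :=
  {p | ∀ k, p k ∈ P}

/-- Slow scheduling transitions are admissible: for some `δ > 0`, every `P`-valued signal that
follows an admissible trajectory `p₁` up to time `0`, then moves with steps of (Euclidean) size
at most `δ` until time `τ`, and follows the delayed admissible trajectory `p₂` from time `τ` on,
is admissible. This holds for `P^ℤ` and for rate-bounded scheduling signals. -/
def AdmitsSlowTransitions {np : ℕ} (P : Set (Fin np → ℝ)) (S : Set (ℤ → Fin np → ℝ)) : Prop :=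
  ∃ δ : ℝ, 0 < δ ∧ ∀ p₁ ∈ S, ∀ p₂ ∈ S, ∀ τ : ℕ, ∀ q ∈ valuedIn P,
    (∀ k : ℤ, k ≤ 0 → q k = p₁ k) →
    (∀ k : ℤ, (τ : ℤ) ≤ k → q k = p₂ (k - τ)) →
    (∀ k : ℤ, 0 ≤ k → k < τ → ‖WithLp.toLp 2 (q (k + 1) - q k)‖ ≤ δ) →
    q ∈ S

namespace StateSpace

variable {nu np nx ny : ℕ}

/-- The behavior: all `(u, p, x, y)` on `ℤ` with admissible scheduling `p ∈ S` that satisfy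
the state and output equations at all times. -/
def behavior (sys : StateSpace nu np nx ny) (S : Set (ℤ → Fin np → ℝ)) :
    Set (ℤ → Point nu np nx ny) :=
  {w | (fun k => (w k).2.1) ∈ S ∧
    ∀ k : ℤ,
      (w (k + 1)).2.2.1
          = sys.A.eval (w k).2.1 *ᵥ (w k).2.2.1 + sys.B.eval (w k).2.1 *ᵥ (w k).1 ∧
      (w k).2.2.2
          = sys.C.eval (w k).2.1 *ᵥ (w k).2.2.1 + sys.D.eval (w k).2.1 *ᵥ (w k).1}

/-- The manifest (input-output) behavior: the projection on `(u, p, y)`. -/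
def manifestBehavior (sys : StateSpace nu np nx ny) (S : Set (ℤ → Fin np → ℝ)) :
    Set (ℤ → IOPoint nu np ny) :=
  (fun w k => ((w k).1, (w k).2.1, (w k).2.2.2)) '' sys.behavior S

/-- The state transition matrix `A(p (k+j-1)) ⋯ A(p (k+1)) A(p k)` over `j` steps from time `k`. -/
def transition (sys : StateSpace nu np nx ny) (p : ℤ → Fin np → ℝ) (k : ℤ) :
    ℕ → Matrix (Fin nx) (Fin nx) ℝ
  | 0 => 1
  | j + 1 => sys.A.eval (p (k + j)) * sys.transition p k j

/-- The `nx`-step observability matrix along `p`, with block rows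
`C(p i) A(p (i-1)) ⋯ A(p 0)` for `0 ≤ i < nx`. -/
def observabilityMatrix (sys : StateSpace nu np nx ny) (p : ℤ → Fin np → ℝ) :
    Matrix (Fin nx × Fin ny) (Fin nx) ℝ :=
  Matrix.of fun r c =>
    (sys.C.eval (p (r.1 : ℕ)) * sys.transition p 0 (r.1 : ℕ)) r.2 c

/-- The `nx`-step controllability matrix along `p`, with block columns
`A(p (nx-1)) ⋯ A(p (i+1)) B(p i)` for `0 ≤ i < nx`. -/
def controllabilityMatrix (sys : StateSpace nu np nx ny) (p : ℤ → Fin np → ℝ) :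
    Matrix (Fin nx) (Fin nx × Fin nu) ℝ :=
  Matrix.of fun r c =>
    (sys.transition p (((c.1 : ℕ) : ℤ) + 1) (nx - 1 - (c.1 : ℕ)) *
      sys.B.eval (p (c.1 : ℕ))) r c.2

/-- Structural state observability on `P`: the `nx`-step observability matrix, as a polynomial
function of `p 0, …, p (nx-1)` ranging independently over `P`, has generic rank `nx`. The generic
rank of a polynomial matrix on a convex set is `nx` iff rank `nx` is attained at some point. -/
def StructurallyObservable (sys : StateSpace nu np nx ny) (P : Set (Fin np → ℝ)) : Prop :=
  ∃ p ∈ valuedIn P, (sys.observabilityMatrix p).rank = nx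

/-- Structural state controllability on `P`: the `nx`-step controllability matrix has generic
rank `nx`. -/
def StructurallyControllable (sys : StateSpace nu np nx ny) (P : Set (Fin np → ℝ)) : Prop :=
  ∃ p ∈ valuedIn P, (sys.controllabilityMatrix p).rank = nx

/-- State-minimality: structural state observability and controllability. -/
def IsMinimal (sys : StateSpace nu np nx ny) (P : Set (Fin np → ℝ)) : Prop :=
  sys.StructurallyObservable P ∧ sys.StructurallyControllable P

end StateSpace

/-- The solution set of the shifted-affine input-output representation
`y k + ∑_{i=1}^{na} aᵢ(p (k-i)) y (k-i) = ∑_{i=1}^{nb} bᵢ(p (k-i)) u (k-i)`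
with scheduling in `S`; the entry `i : Fin na` of `a` is the coefficient at lag `i + 1`. -/
def shiftedAffineIOBehavior {nu np ny na nb : ℕ} (a : Fin na → AffineMatrix ny ny np)
    (b : Fin nb → AffineMatrix ny nu np) (S : Set (ℤ → Fin np → ℝ)) :
    Set (ℤ → IOPoint nu np ny) :=
  {v | (fun k => (v k).2.1) ∈ S ∧
    ∀ k : ℤ,
      (v k).2.2 + ∑ i : Fin na,
          (a i).eval (v (k - ((i : ℕ) + 1))).2.1 *ᵥ (v (k - ((i : ℕ) + 1))).2.2
        = ∑ i : Fin nb,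
          (b i).eval (v (k - ((i : ℕ) + 1))).2.1 *ᵥ (v (k - ((i : ℕ) + 1))).1}

/-- The input-output map admits a shifted-affine realization: the manifest behavior is the
solution set of a shifted-affine input-output representation with `na, nb ≥ 1`. -/
def AdmitsShiftedAffineForm {nu np nx ny : ℕ} (sys : StateSpace nu np nx ny)
    (S : Set (ℤ → Fin np → ℝ)) : Prop :=
  ∃ na nb : ℕ, 1 ≤ na ∧ 1 ≤ nb ∧
    ∃ (a : Fin na → AffineMatrix ny ny np) (b : Fin nb → AffineMatrix ny nu np),
      sys.manifestBehavior S = shiftedAffineIOBehavior a b S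

/-- Controllability of a (time-invariant) behavior on `ℤ` in the sense of Willems: any past
trajectory can be connected, after some delay, with any future trajectory. -/
def IsControllable {W : Type*} (𝔅 : Set (ℤ → W)) : Prop :=
  ∀ w₁ ∈ 𝔅, ∀ w₂ ∈ 𝔅, ∃ τ : ℕ, ∃ w ∈ 𝔅,
    (∀ k : ℤ, k ≤ 0 → w k = w₁ k) ∧ (∀ k : ℤ, (τ : ℤ) ≤ k → w k = w₂ (k - τ))

/-- The quadratic form `W(x, p) = xᵀ P(p) x`. -/
def quadForm {np nx : ℕ} (Pmat : (Fin np → ℝ) → Matrix (Fin nx) (Fin nx) ℝ)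
    (x : Fin nx → ℝ) (p : Fin np → ℝ) : ℝ :=
  x ⬝ᵥ (Pmat p *ᵥ x)

end LPV

namespace LPV

/-! Controllability. The controllability matrix is polynomial in the scheduling, so full rank at one
point of a convex set forces full rank at windows arbitrarily close to any given value. The
connecting scheduling moves slowly to the initial value of the second trajectory, stays near it for
`nx` steps on such a window, during which the state is steered to its target, and then follows the
second trajectory.

IOSS. The shifted-affine equation has a natural state: for each `i`, the part `z i` of the output at
time `k + i` that is determined by the data before `k` (`pastContribution`). It obeys the shift `z i
(k+1) = z (i+1) k + bᵢ u k - aᵢ y k`, where `aᵢ`, `bᵢ` are the coefficients at lag `i + 1` evaluated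
at `p k`. It vanishes for `i ≥ na + nb`. On responses with zero past, both `z i` and `x k` depend
only on data before `k`, so the future may be replaced by constant scheduling `v` and zero input.
This yields `z i = G i x` with matrices `G i` that do not depend on the scheduling (`observerRow`,
`pastContribution_eq`). Because every state is reachable with arbitrary present scheduling and
input, these relations become matrix identities on all of `P`, and observability makes the `G i`
jointly injective. In these coordinates the system is a nilpotent shift driven by `u` and `y`, so a
constant weighted sum of the `‖G i x‖ ^ 2` is a Lyapunov function.

The form is assumed only along admissible scheduling. It extends to all `P`-valued scheduling
because a response with zero past is polynomial along the segment from a constant scheduling, and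
short segments are admissible (`zeroPastOutput_shiftedAffine`). -/

/-! ### Analytic dependence along scheduling segments. -/

theorem AffineMatrix.eval_segment {m n np : ℕ} (M : AffineMatrix m n np) (v w : Fin np → ℝ)
    (t : ℝ) : M.eval (v + t • (w - v)) = M.eval v + t • (M.eval w - M.eval v) := by
  ext i j
  simp only [AffineMatrix.eval, Matrix.add_apply, Matrix.sum_apply, Matrix.smul_apply,
    Pi.add_apply, Pi.smul_apply, Pi.sub_apply, smul_eq_mul, Matrix.sub_apply]
  rw [add_sub_add_left_eq_sub, ← Finset.sum_sub_distrib, Finset.mul_sum, add_assoc,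
    ← Finset.sum_add_distrib]
  congr 1
  refine Finset.sum_congr rfl fun l _ => ?_
  ring

theorem AffineMatrix.analyticAt_eval_segment {m n np : ℕ} (M : AffineMatrix m n np)
    (v w : Fin np → ℝ) (i : Fin m) (j : Fin n) (t : ℝ) :
    AnalyticAt ℝ (fun t => M.eval (v + t • (w - v)) i j) t := by
  simp only [AffineMatrix.eval_segment, Matrix.add_apply, Matrix.smul_apply, Matrix.sub_apply,
    smul_eq_mul]
  fun_prop

theorem AffineMatrix.continuous_eval {m n np : ℕ} (M : AffineMatrix m n np) :
    Continuous M.eval := by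
  unfold AffineMatrix.eval
  fun_prop

theorem analyticAt_mulVec {m n : ℕ} {M : ℝ → Matrix (Fin m) (Fin n) ℝ} {x : ℝ → Fin n → ℝ}
    {t : ℝ} (hM : ∀ i j, AnalyticAt ℝ (fun t => M t i j) t)
    (hx : ∀ j, AnalyticAt ℝ (fun t => x t j) t) (i : Fin m) :
    AnalyticAt ℝ (fun t => (M t *ᵥ x t) i) t := by
  simp only [Matrix.mulVec, dotProduct]
  exact Finset.analyticAt_fun_sum _ fun j _ => (hM i j).mul (hx j)

theorem analyticAt_matrix_mul {l m n : Type*} [Fintype m] {M : ℝ → Matrix l m ℝ}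
    {N : ℝ → Matrix m n ℝ} {t : ℝ} (hM : ∀ i j, AnalyticAt ℝ (fun t => M t i j) t)
    (hN : ∀ i j, AnalyticAt ℝ (fun t => N t i j) t) (i : l) (j : n) :
    AnalyticAt ℝ (fun t => (M t * N t) i j) t := by
  simp only [Matrix.mul_apply]
  exact Finset.analyticAt_fun_sum _ fun k _ => (hM i k).mul (hN k j)

theorem analyticAt_det {n : Type*} [Fintype n] [DecidableEq n] {M : ℝ → Matrix n n ℝ} {t : ℝ}
    (hM : ∀ i j, AnalyticAt ℝ (fun t => M t i j) t) :
    AnalyticAt ℝ (fun t => (M t).det) t := by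
  simp only [Matrix.det_apply']
  exact Finset.analyticAt_fun_sum _ fun σ _ =>
    analyticAt_const.mul (Finset.analyticAt_fun_prod _ fun i _ => hM _ _)

/-- An entire real function vanishing on a right neighbourhood of `0` vanishes everywhere. -/
theorem eq_zero_of_analytic_of_eq_zero_Ioc {f : ℝ → ℝ} (hf : ∀ t, AnalyticAt ℝ f t) {ε : ℝ}
    (hε : 0 < ε) (h : ∀ t, 0 < t → t ≤ ε → f t = 0) (t : ℝ) : f t = 0 := by
  have hloc : f =ᶠ[𝓝 (ε / 2)] 0 := by
    filter_upwards [Ioo_mem_nhds (half_pos hε) (half_lt_self hε)] with s hs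
    exact h s hs.1 hs.2.le
  exact congrFun (AnalyticOnNhd.eq_of_eventuallyEq (f := f) (g := 0)
    (fun s _ => hf s) (fun s _ => analyticAt_const) hloc) t

theorem exists_norm_toLp_le {np : ℕ} {P : Set (Fin np → ℝ)} (hP : IsCompact P) :
    ∃ R : ℝ, 0 < R ∧ ∀ v ∈ P, ‖WithLp.toLp 2 v‖ ≤ R := by
  obtain ⟨R, hR⟩ := hP.exists_bound_of_continuousOn
    (f := fun v : Fin np → ℝ => WithLp.toLp 2 v) (by fun_prop)
  exact ⟨max R 1, by positivity, fun v hv => (hR v hv).trans (le_max_left _ _)⟩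

/-! ### State runs, steering and controllability of the behavior. -/

namespace StateSpace

variable {nu np nx ny : ℕ}

/-- The state after `j` steps, starting in `x₀` at time `s`. -/
def run (sys : StateSpace nu np nx ny) (p : ℤ → Fin np → ℝ) (u : ℤ → Fin nu → ℝ) (s : ℤ)
    (x₀ : Fin nx → ℝ) : ℕ → Fin nx → ℝ
  | 0 => x₀
  | j + 1 => sys.A.eval (p (s + j)) *ᵥ sys.run p u s x₀ j + sys.B.eval (p (s + j)) *ᵥ u (s + j)

theorem run_congr (sys : StateSpace nu np nx ny) {p p' : ℤ → Fin np → ℝ} {u u' : ℤ → Fin nu → ℝ}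
    {s s' : ℤ} (x₀ : Fin nx → ℝ) {n : ℕ} (hp : ∀ j : ℕ, j < n → p (s + j) = p' (s' + j))
    (hu : ∀ j : ℕ, j < n → u (s + j) = u' (s' + j)) :
    sys.run p u s x₀ n = sys.run p' u' s' x₀ n := by
  induction n with
  | zero => rfl
  | succ n ih =>
    simp only [run]
    rw [ih (fun j hj => hp j (by omega)) (fun j hj => hu j (by omega)), hp n (by omega),
      hu n (by omega)]

theorem run_add (sys : StateSpace nu np nx ny) (p : ℤ → Fin np → ℝ) (u : ℤ → Fin nu → ℝ) (s : ℤ)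
    (x₀ : Fin nx → ℝ) (m n : ℕ) :
    sys.run p u s x₀ (m + n) = sys.run p u (s + m) (sys.run p u s x₀ m) n := by
  induction n with
  | zero => rfl
  | succ n ih =>
    rw [← Nat.add_assoc]
    simp only [run]
    rw [ih]
    push_cast
    simp only [add_assoc]

theorem run_eq_sum (sys : StateSpace nu np nx ny) (p : ℤ → Fin np → ℝ) (u : ℤ → Fin nu → ℝ)
    (s : ℤ) (x₀ : Fin nx → ℝ) (n : ℕ) :
    sys.run p u s x₀ n = sys.transition p s n *ᵥ x₀ + ∑ i ∈ Finset.range n,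
      (sys.transition p (s + i + 1) (n - 1 - i) * sys.B.eval (p (s + i))) *ᵥ u (s + i) := by
  induction n with
  | zero => simp [run, transition]
  | succ n ih =>
    simp only [run]
    rw [ih, Finset.sum_range_succ, Matrix.mulVec_add, Matrix.mulVec_sum, transition,
      Matrix.mulVec_mulVec, add_assoc]
    congr 2
    · refine Finset.sum_congr rfl fun i hi => ?_
      rw [Finset.mem_range] at hi
      obtain ⟨d, rfl⟩ : ∃ d, n = i + 1 + d := ⟨n - (i + 1), by omega⟩
      have h1 : i + 1 + d - 1 - i = d := by omega
      have h2 : i + 1 + d + 1 - 1 - i = d + 1 := by omega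
      rw [h1, h2, transition, Matrix.mulVec_mulVec, ← Matrix.mul_assoc]
      congr 5
      push_cast
      ring
    · have h : n + 1 - 1 - n = 0 := by omega
      rw [h, transition, Matrix.one_mul]

theorem controllabilityMatrix_mulVec (sys : StateSpace nu np nx ny) (p : ℤ → Fin np → ℝ)
    (v : Fin nx × Fin nu → ℝ) :
    sys.controllabilityMatrix p *ᵥ v = ∑ i : Fin nx,
      (sys.transition p (((i : ℕ) : ℤ) + 1) (nx - 1 - i) * sys.B.eval (p (i : ℕ))) *ᵥ
        fun l => v (i, l) := by
  ext r
  simp only [Matrix.mulVec, dotProduct, Fintype.sum_prod_type, Finset.sum_apply,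
    controllabilityMatrix, Matrix.of_apply]

theorem exists_run_eq (sys : StateSpace nu np nx ny) {p : ℤ → Fin np → ℝ}
    (h : Function.Surjective (sys.controllabilityMatrix p).mulVec) (x₀ x₁ : Fin nx → ℝ) :
    ∃ u, sys.run p u 0 x₀ nx = x₁ := by
  obtain ⟨v, hv⟩ := h (x₁ - sys.transition p 0 nx *ᵥ x₀)
  refine ⟨fun k l => if hk : k.toNat < nx then v (⟨k.toNat, hk⟩, l) else 0, ?_⟩
  rw [controllabilityMatrix_mulVec] at hv
  rw [run_eq_sum, ← eq_sub_iff_add_eq', ← hv, Finset.sum_range]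
  refine Finset.sum_congr rfl fun i _ => ?_
  simp

theorem analyticAt_transition_segment (sys : StateSpace nu np nx ny) (v : Fin np → ℝ)
    (p : ℤ → Fin np → ℝ) (s : ℤ) (n : ℕ) (t : ℝ) (i j : Fin nx) :
    AnalyticAt ℝ (fun t => sys.transition (fun k => v + t • (p k - v)) s n i j) t := by
  induction n generalizing i j with
  | zero => simp only [transition]; fun_prop
  | succ n ih =>
    simp only [transition]
    exact analyticAt_matrix_mul (fun i j => sys.A.analyticAt_eval_segment _ _ i j t) ih i j

theorem analyticAt_run_segment (sys : StateSpace nu np nx ny) (v : Fin np → ℝ)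
    (p : ℤ → Fin np → ℝ) (u : ℤ → Fin nu → ℝ) (s : ℤ) (x₀ : Fin nx → ℝ) (n : ℕ) (t : ℝ)
    (i : Fin nx) :
    AnalyticAt ℝ (fun t => sys.run (fun k => v + t • (p k - v)) u s x₀ n i) t := by
  induction n generalizing i with
  | zero => simp only [run]; fun_prop
  | succ n ih =>
    simp only [run]
    exact (analyticAt_mulVec (fun i j => sys.A.analyticAt_eval_segment _ _ i j t) ih i).add
      (analyticAt_mulVec (x := fun _ => u (s + n))
        (fun i j => sys.B.analyticAt_eval_segment v (p (s + n)) i j t)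
        (fun _ => analyticAt_const) i)

theorem StructurallyControllable.exists_surjective {sys : StateSpace nu np nx ny}
    {P : Set (Fin np → ℝ)} (h : sys.StructurallyControllable P) :
    ∃ p ∈ valuedIn P, Function.Surjective (sys.controllabilityMatrix p).mulVec := by
  obtain ⟨p, hp, hr⟩ := h
  refine ⟨p, hp, ?_⟩
  have htop : LinearMap.range (sys.controllabilityMatrix p).mulVecLin = ⊤ := by
    apply Submodule.eq_top_of_finrank_eq
    simpa [Matrix.rank] using hr
  exact LinearMap.range_eq_top.mp htop

/-- Scheduling windows with full controllability exist near every point of a convex set. -/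
theorem StructurallyControllable.exists_surjective_near {sys : StateSpace nu np nx ny}
    {P : Set (Fin np → ℝ)} (hPcompact : IsCompact P) (hPconvex : Convex ℝ P)
    (h : sys.StructurallyControllable P) {v : Fin np → ℝ} (hv : v ∈ P) {ε : ℝ} (hε : 0 < ε) :
    ∃ p ∈ valuedIn P, (∀ k, ‖WithLp.toLp 2 (p k - v)‖ ≤ ε) ∧
      Function.Surjective (sys.controllabilityMatrix p).mulVec := by
  obtain ⟨p, hp, hs⟩ := h.exists_surjective
  obtain ⟨Q, hQ⟩ := Matrix.mulVec_surjective_iff_exists_right_inverse.mp hs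
  obtain ⟨R, hR0, hR⟩ := exists_norm_toLp_le hPcompact
  -- The window is contracted towards `v` by the factor `t`. With `Q` a right inverse at `t = 1`,
  -- the determinant equals 1 there, so it cannot vanish for all small `t > 0`.
  have hana : ∀ t, AnalyticAt ℝ
      (fun t : ℝ => (sys.controllabilityMatrix (fun k => v + t • (p k - v)) * Q).det) t := by
    intro t
    refine analyticAt_det (analyticAt_matrix_mul (fun i j => ?_) fun i j => analyticAt_const)
    simp only [controllabilityMatrix, Matrix.of_apply]
    exact analyticAt_matrix_mul (fun i j => sys.analyticAt_transition_segment _ _ _ _ _ i j)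
      (fun i j => sys.B.analyticAt_eval_segment _ _ i j t) _ _
  obtain ⟨t, ht0, ht1, ht⟩ : ∃ t : ℝ, 0 < t ∧ t ≤ min 1 (ε / (2 * R)) ∧
      (sys.controllabilityMatrix (fun k => v + t • (p k - v)) * Q).det ≠ 0 := by
    by_contra! hcon
    have := eq_zero_of_analytic_of_eq_zero_Ioc hana (ε := min 1 (ε / (2 * R)))
      (by positivity) hcon 1
    simp [hQ] at this
  refine ⟨fun k => v + t • (p k - v), fun k => ?_, fun k => ?_, ?_⟩
  · exact hPconvex.add_smul_sub_mem hv (hp k) ⟨ht0.le, ht1.trans (min_le_left _ _)⟩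
  · have h1 : ‖WithLp.toLp 2 (p k - v)‖ ≤ 2 * R := by
      rw [WithLp.toLp_sub]
      exact (norm_sub_le _ _).trans (by linarith [hR _ (hp k), hR _ hv])
    have h2 : t * (2 * R) ≤ ε := by
      rw [← le_div_iff₀ (by positivity)]
      exact ht1.trans (min_le_right _ _)
    rw [add_sub_cancel_left, WithLp.toLp_smul, norm_smul, Real.norm_of_nonneg ht0.le]
    exact (mul_le_mul_of_nonneg_left h1 ht0.le).trans h2
  · rw [Matrix.mulVec_surjective_iff_exists_right_inverse]
    refine ⟨Q * (sys.controllabilityMatrix (fun k => v + t • (p k - v)) * Q)⁻¹, ?_⟩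
    rw [← Matrix.mul_assoc, Matrix.mul_nonsing_inv _ (isUnit_iff_ne_zero.mpr ht)]

theorem StructurallyObservable.exists_injective {sys : StateSpace nu np nx ny}
    {P : Set (Fin np → ℝ)} (h : sys.StructurallyObservable P) :
    ∃ p ∈ valuedIn P, ∀ x, (∀ j : ℕ,
      sys.C.eval (p j) *ᵥ (sys.transition p 0 j *ᵥ x) = 0) → x = 0 := by
  obtain ⟨p, hp, hr⟩ := h
  refine ⟨p, hp, fun x hx => ?_⟩
  have hker : LinearMap.ker (sys.observabilityMatrix p).mulVecLin = ⊥ := by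
    have := LinearMap.finrank_range_add_finrank_ker (sys.observabilityMatrix p).mulVecLin
    rw [Matrix.rank] at hr
    rw [hr] at this
    apply Submodule.finrank_eq_zero.mp
    simpa using this
  refine LinearMap.ker_eq_bot'.mp hker x ?_
  ext r
  have := congrFun (hx (r.1 : ℕ)) r.2
  rw [Matrix.mulVec_mulVec] at this
  exact this

/-- Two trajectories of the behavior are joined by a run from the first to the second along an
admissible scheduling trajectory. -/
theorem exists_mem_behavior_of_run (sys : StateSpace nu np nx ny) {S : Set (ℤ → Fin np → ℝ)}
    {w₁ w₂ : ℤ → Point nu np nx ny} (h₁ : w₁ ∈ sys.behavior S) (h₂ : w₂ ∈ sys.behavior S)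
    {τ : ℕ} (hτ : 0 < τ) {q : ℤ → Fin np → ℝ} (hq : q ∈ S)
    (hq₁ : ∀ k : ℤ, k ≤ 0 → q k = (w₁ k).2.1)
    (hq₂ : ∀ k : ℤ, (τ : ℤ) ≤ k → q k = (w₂ (k - τ)).2.1)
    {u : ℤ → Fin nu → ℝ} (hu₁ : ∀ k : ℤ, k ≤ 0 → u k = (w₁ k).1)
    (hu₂ : ∀ k : ℤ, (τ : ℤ) ≤ k → u k = (w₂ (k - τ)).1)
    (hrun : sys.run q u 0 (w₁ 0).2.2.1 τ = (w₂ 0).2.2.1) :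
    ∃ w ∈ sys.behavior S,
      (∀ k : ℤ, k ≤ 0 → w k = w₁ k) ∧ (∀ k : ℤ, (τ : ℤ) ≤ k → w k = w₂ (k - τ)) := by
  -- The pieces agree at the seams: trivially at 0, and at `τ` by `hrun`.
  obtain ⟨x, hx⟩ : ∃ x : ℤ → Fin nx → ℝ, x = fun k => if k ≤ 0 then (w₁ k).2.2.1 else
      if (τ : ℤ) ≤ k then (w₂ (k - τ)).2.2.1 else sys.run q u 0 (w₁ 0).2.2.1 k.toNat := ⟨_, rfl⟩
  have hx₁ : ∀ k : ℤ, k ≤ 0 → x k = (w₁ k).2.2.1 := fun k hk => by rw [hx]; simp [hk]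
  have hx₂ : ∀ k : ℤ, (τ : ℤ) ≤ k → x k = (w₂ (k - τ)).2.2.1 := fun k hk => by
    have : ¬ k ≤ 0 := by omega
    rw [hx]; simp [hk, this]
  have hx₃ : ∀ j : ℕ, j ≤ τ → x j = sys.run q u 0 (w₁ 0).2.2.1 j := fun j hj => by
    rcases Nat.eq_zero_or_pos j with rfl | h0
    · rw [hx₁ _ (by simp)]; rfl
    rcases hj.eq_or_lt with rfl | hlt
    · rw [hx₂ _ le_rfl, hrun, sub_self]
    · have h1 : ¬ (j : ℤ) ≤ 0 := by omega
      have h2 : ¬ (τ : ℤ) ≤ j := by omega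
      rw [hx]; simp only [h1, h2, if_false, Int.toNat_natCast]
  refine ⟨fun k => (u k, q k, x k, sys.C.eval (q k) *ᵥ x k + sys.D.eval (q k) *ᵥ u k),
    ⟨hq, fun k => ⟨?_, rfl⟩⟩, fun k hk => ?_, fun k hk => ?_⟩
  · change x (k + 1) = sys.A.eval (q k) *ᵥ x k + sys.B.eval (q k) *ᵥ u k
    rcases lt_or_ge k 0 with hk | hk
    · rw [hx₁ _ hk.le, hx₁ (k + 1) (by omega), hq₁ _ hk.le, hu₁ _ hk.le]
      exact (h₁.2 k).1
    rcases lt_or_ge k τ with hk' | hk'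
    · lift k to ℕ using hk
      have := hx₃ (k + 1) (by omega)
      push_cast at this
      rw [this, run, hx₃ k (by omega), zero_add]
    · rw [hx₂ _ hk', hx₂ (k + 1) (by omega), hq₂ _ hk', hu₂ _ hk', add_sub_right_comm]
      exact (h₂.2 (k - τ)).1
  · have := (h₁.2 k).2
    simp only [hu₁ k hk, hq₁ k hk, hx₁ k hk, ← this]
  · have := (h₂.2 (k - τ)).2
    simp only [hu₂ k hk, hq₂ k hk, hx₂ k hk, ← this]

/-- A slow path from the past of `p₁` to the future of `p₂`, along which the state can be steered
arbitrarily during the last `nx` steps before reaching `p₂`. -/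
theorem exists_slow_transition (sys : StateSpace nu np nx ny) {P : Set (Fin np → ℝ)}
    (hPcompact : IsCompact P) (hPconvex : Convex ℝ P) (hctr : sys.StructurallyControllable P)
    {p₁ p₂ : ℤ → Fin np → ℝ} (hp₁ : p₁ ∈ valuedIn P) (hp₂ : p₂ ∈ valuedIn P) {δ : ℝ}
    (hδ : 0 < δ) :
    ∃ m : ℕ, 0 < m ∧ ∃ q ∈ valuedIn P,
      (∀ k : ℤ, k ≤ 0 → q k = p₁ k) ∧
      (∀ k : ℤ, ((m + 1 + nx : ℕ) : ℤ) ≤ k → q k = p₂ (k - (m + 1 + nx : ℕ))) ∧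
      (∀ k : ℤ, 0 ≤ k → k < (m + 1 + nx : ℕ) → ‖WithLp.toLp 2 (q (k + 1) - q k)‖ ≤ δ) ∧
      Function.Surjective (sys.controllabilityMatrix fun k => q (m + 1 + k)).mulVec := by
  obtain ⟨pc, hpc, hnear, hsurj⟩ :=
    hctr.exists_surjective_near hPcompact hPconvex (hp₂ 0) (half_pos hδ)
  -- With `m` interpolation steps each step is shorter than `δ`. Time `m` is spent at `p₂ 0`, times
  -- `m + 1, …, m + nx` on the window `pc`, and time `m + 1 + nx` again at `p₂ 0`. From `m` on all
  -- values lie within `δ / 2` of `p₂ 0`, hence the steps there are at most `δ`.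
  obtain ⟨m, hm⟩ := exists_nat_gt (‖WithLp.toLp 2 (p₂ 0 - p₁ 0)‖ / δ)
  have hmR : (0 : ℝ) < m := lt_of_le_of_lt (by positivity) hm
  have hm0 : 0 < m := by exact_mod_cast hmR
  obtain ⟨q, hq⟩ : ∃ q : ℤ → Fin np → ℝ, q = fun k => if k ≤ 0 then p₁ k else
      if k ≤ m then p₁ 0 + ((k : ℝ) / m) • (p₂ 0 - p₁ 0) else
      if k ≤ m + nx then pc (k - (m + 1)) else p₂ (k - (m + 1 + nx : ℕ)) := ⟨_, rfl⟩
  have h₁ : ∀ k : ℤ, k ≤ 0 → q k = p₁ k := fun k hk => by rw [hq]; simp [hk]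
  have hlin : ∀ k : ℤ, 0 ≤ k → k ≤ m → q k = p₁ 0 + ((k : ℝ) / m) • (p₂ 0 - p₁ 0) := by
    intro k hk hkm
    rcases hk.eq_or_lt with rfl | hk
    · rw [h₁ _ le_rfl]; simp
    · rw [hq]; simp [hk.not_ge, hkm]
  have hwin : ∀ k : ℤ, m < k → k ≤ m + nx → q k = pc (k - (m + 1)) := by
    intro k hk hk'
    have : ¬ k ≤ 0 := by omega
    rw [hq]; simp [hk.not_ge, hk', this]
  have h₂ : ∀ k : ℤ, ((m + 1 + nx : ℕ) : ℤ) ≤ k → q k = p₂ (k - (m + 1 + nx : ℕ)) := by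
    intro k hk
    push_cast at hk
    have h1 : ¬ k ≤ 0 := by omega
    have h2 : ¬ k ≤ m := by omega
    have h3 : ¬ k ≤ m + nx := by omega
    rw [hq]; simp only [h1, h2, h3, if_false]
  have hclose : ∀ k : ℤ, m ≤ k → k ≤ m + 1 + nx → ‖WithLp.toLp 2 (q k - p₂ 0)‖ ≤ δ / 2 := by
    intro k hk hk'
    rcases hk.eq_or_lt with rfl | hk
    · rw [hlin _ (by omega) le_rfl]
      simpa [div_self hmR.ne'] using (half_pos hδ).le
    rcases hk'.eq_or_lt with rfl | hk'
    · rw [h₂ _ (by push_cast; rfl)]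
      simpa using (half_pos hδ).le
    · rw [hwin k hk (by omega)]
      exact hnear _
  refine ⟨m, hm0, q, fun k => ?_, h₁, h₂, fun k hk hk' => ?_, ?_⟩
  · rcases le_or_gt k 0 with hk | hk
    · rw [h₁ k hk]; exact hp₁ k
    rcases le_or_gt k m with hk' | hk'
    · rw [hlin k hk.le hk']
      refine hPconvex.add_smul_sub_mem (hp₁ 0) (hp₂ 0) ⟨by positivity, ?_⟩
      rw [div_le_one hmR]
      exact_mod_cast hk'
    rcases le_or_gt k (m + nx) with hk'' | hk''
    · rw [hwin k hk' hk'']; exact hpc _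
    · rw [h₂ k (by push_cast; omega)]; exact hp₂ _
  · rcases lt_or_ge k m with hkm | hkm
    · rw [hlin k hk hkm.le, hlin (k + 1) (by omega) (by omega), add_sub_add_left_eq_sub, ← sub_smul]
      have : ((k + 1 : ℤ) : ℝ) / m - k / m = 1 / m := by push_cast; ring
      rw [this, WithLp.toLp_smul, norm_smul, Real.norm_of_nonneg (by positivity),
        one_div_mul_eq_div, div_le_iff₀ hmR, mul_comm, ← div_le_iff₀ hδ]
      exact hm.le
    · push_cast at hk'
      have : q (k + 1) - q k = (q (k + 1) - p₂ 0) - (q k - p₂ 0) := by abel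
      rw [this, WithLp.toLp_sub]
      refine (norm_sub_le _ _).trans ?_
      linarith [hclose k hkm (by omega), hclose (k + 1) (by omega) (by omega)]
  · have : sys.controllabilityMatrix (fun k => q (m + 1 + k)) = sys.controllabilityMatrix pc := by
      have htr : ∀ (i : Fin nx) (n : ℕ), (i : ℕ) + 1 + n ≤ nx →
          sys.transition (fun k => q (m + 1 + k)) (((i : ℕ) : ℤ) + 1) n =
            sys.transition pc (((i : ℕ) : ℤ) + 1) n := by
        intro i n hn
        induction n with
        | zero => rfl
        | succ n ih =>
          simp only [transition]
          rw [ih (by omega), hwin _ (by omega) (by omega)]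
          congr 3
          ring
      ext r c
      have hc := c.1.2
      simp only [controllabilityMatrix, Matrix.of_apply]
      rw [htr _ _ (by omega), hwin _ (by omega) (by omega), add_sub_cancel_left]
    rw [this]
    exact hsurj

theorem isControllable_behavior (sys : StateSpace nu np nx ny) {P : Set (Fin np → ℝ)}
    (hPcompact : IsCompact P) (hPconvex : Convex ℝ P) {S : Set (ℤ → Fin np → ℝ)}
    (hSP : S ⊆ valuedIn P) (hS : AdmitsSlowTransitions P S)
    (hctr : sys.StructurallyControllable P) : IsControllable (sys.behavior S) := by
  intro w₁ h₁ w₂ h₂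
  obtain ⟨δ, hδ, hS⟩ := hS
  obtain ⟨m, hm, q, hqP, hq₁, hq₂, hslow, hsurj⟩ :=
    sys.exists_slow_transition hPcompact hPconvex hctr (hSP h₁.1) (hSP h₂.1) hδ
  have hqS : q ∈ S := hS _ h₁.1 _ h₂.1 _ q hqP hq₁ hq₂ hslow
  obtain ⟨ξ, hξ⟩ : ∃ ξ, ξ = sys.run q (fun k => (w₁ k).1) 0 (w₁ 0).2.2.1 (m + 1) := ⟨_, rfl⟩
  obtain ⟨v, hv⟩ := sys.exists_run_eq hsurj ξ (w₂ 0).2.2.1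
  -- The input on `1, …, m` is arbitrary, since the steering starts from whatever state `ξ` results.
  obtain ⟨u, hu⟩ : ∃ u : ℤ → Fin nu → ℝ, u = fun k : ℤ => if k < m + 1 then (w₁ k).1 else
    if k < (m + 1 + nx : ℕ) then v (k - (m + 1)) else (w₂ (k - (m + 1 + nx : ℕ))).1 := ⟨_, rfl⟩
  refine ⟨m + 1 + nx, sys.exists_mem_behavior_of_run h₁ h₂ (by omega) hqS hq₁ hq₂ (u := u)
    (fun k hk => ?_) (fun k hk => ?_) ?_⟩
  · have : k < m + 1 := by omega
    rw [hu]; simp only [this, if_true]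
  · have h1 : ¬ k < m + 1 := by push_cast at hk; omega
    rw [hu]; simp only [h1, hk.not_gt, if_false]
  · rw [run_add, ← hv]
    have : sys.run q u 0 (w₁ 0).2.2.1 (m + 1) = ξ := by
      rw [hξ]
      refine sys.run_congr _ (fun _ _ => rfl) fun j hj => ?_
      have : (0 : ℤ) + j < m + 1 := by omega
      rw [hu]; simp only [this, if_true]
    rw [this]
    refine sys.run_congr _ (fun j hj => ?_) fun j hj => ?_
    · push_cast
      congr 1
      ring
    · have h1 : ¬ (0 : ℤ) + (m + 1 : ℕ) + j < m + 1 := by push_cast; omega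
      have h2 : (0 : ℤ) + (m + 1 : ℕ) + j < (m + 1 + nx : ℕ) := by push_cast; omega
      rw [hu]; simp only [h1, h2, if_true, if_false]
      congr 1
      push_cast
      ring

/-! ### Responses with zero past, and the shifted-affine equation beyond admissible scheduling. -/

variable {na nb : ℕ}

/-- The state trajectory that is zero up to time `1`. -/
def zeroPastState (sys : StateSpace nu np nx ny) (p : ℤ → Fin np → ℝ) (u : ℤ → Fin nu → ℝ)
    (k : ℤ) : Fin nx → ℝ :=
  sys.run p u 1 0 (k - 1).toNat

/-- The output trajectory of `zeroPastState`. -/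
def zeroPastOutput (sys : StateSpace nu np nx ny) (p : ℤ → Fin np → ℝ) (u : ℤ → Fin nu → ℝ)
    (k : ℤ) : Fin ny → ℝ :=
  sys.C.eval (p k) *ᵥ sys.zeroPastState p u k + sys.D.eval (p k) *ᵥ u k

theorem zeroPastState_of_le (sys : StateSpace nu np nx ny) (p : ℤ → Fin np → ℝ)
    (u : ℤ → Fin nu → ℝ) {k : ℤ} (hk : k ≤ 1) : sys.zeroPastState p u k = 0 := by
  have : (k - 1).toNat = 0 := by omega
  rw [zeroPastState, this, run]

theorem zeroPastOutput_of_le (sys : StateSpace nu np nx ny) (p : ℤ → Fin np → ℝ)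
    {u : ℤ → Fin nu → ℝ} (hu : ∀ k ≤ 0, u k = 0) {k : ℤ} (hk : k ≤ 0) :
    sys.zeroPastOutput p u k = 0 := by
  rw [zeroPastOutput, sys.zeroPastState_of_le p u (by omega), hu k hk]
  simp

theorem zeroPastState_succ (sys : StateSpace nu np nx ny) (p : ℤ → Fin np → ℝ)
    {u : ℤ → Fin nu → ℝ} (hu : ∀ k ≤ 0, u k = 0) (k : ℤ) :
    sys.zeroPastState p u (k + 1) =
      sys.A.eval (p k) *ᵥ sys.zeroPastState p u k + sys.B.eval (p k) *ᵥ u k := by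
  rcases le_or_gt k 0 with hk | hk
  · rw [sys.zeroPastState_of_le p u (by omega), sys.zeroPastState_of_le p u (by omega), hu k hk]
    simp
  · obtain ⟨j, rfl⟩ : ∃ j : ℕ, k = 1 + j := ⟨(k - 1).toNat, by omega⟩
    have h1 : (1 + (j : ℤ) + 1 - 1).toNat = j + 1 := by omega
    have h2 : (1 + (j : ℤ) - 1).toNat = j := by omega
    rw [zeroPastState, zeroPastState, h1, h2, run]

theorem zeroPastState_congr (sys : StateSpace nu np nx ny) {p p' : ℤ → Fin np → ℝ}
    {u u' : ℤ → Fin nu → ℝ} {k : ℤ} (hp : ∀ j, 1 ≤ j → j < k → p j = p' j)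
    (hu : ∀ j, 1 ≤ j → j < k → u j = u' j) :
    sys.zeroPastState p u k = sys.zeroPastState p' u' k :=
  sys.run_congr _ (fun j hj => hp _ (by omega) (by omega))
    (fun j hj => hu _ (by omega) (by omega))

/-- Causality, and independence of the scheduling before time 1, where state and input are zero.
This allows the past of an admissible trajectory to be inserted there. -/
theorem zeroPastOutput_congr (sys : StateSpace nu np nx ny) {p p' : ℤ → Fin np → ℝ}
    {u u' : ℤ → Fin nu → ℝ} {k : ℤ} (hp : ∀ j, 1 ≤ j → j ≤ k → p j = p' j)
    (hu : ∀ j, 1 ≤ j → j ≤ k → u j = u' j) (hu₀ : ∀ k ≤ 0, u k = 0) (hu₀' : ∀ k ≤ 0, u' k = 0) :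
    sys.zeroPastOutput p u k = sys.zeroPastOutput p' u' k := by
  rcases le_or_gt k 0 with hk | hk
  · rw [sys.zeroPastOutput_of_le p hu₀ hk, sys.zeroPastOutput_of_le p' hu₀' hk]
  · rw [zeroPastOutput, zeroPastOutput, sys.zeroPastState_congr (fun j h h' => hp j h h'.le)
      (fun j h h' => hu j h h'.le), hp k hk le_rfl, hu k hk le_rfl]

theorem analyticAt_zeroPastOutput_segment (sys : StateSpace nu np nx ny) (v : Fin np → ℝ)
    (p : ℤ → Fin np → ℝ) (u : ℤ → Fin nu → ℝ) (k : ℤ) (t : ℝ) (i : Fin ny) :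
    AnalyticAt ℝ (fun t => sys.zeroPastOutput (fun k => v + t • (p k - v)) u k i) t := by
  simp only [zeroPastOutput]
  exact (analyticAt_mulVec (fun i j => sys.C.analyticAt_eval_segment v (p k) i j t)
    (fun j => sys.analyticAt_run_segment v p u 1 0 _ t j) i).add
    (analyticAt_mulVec (x := fun _ => u k)
      (fun i j => sys.D.analyticAt_eval_segment v (p k) i j t) (fun _ => analyticAt_const) i)

/-- The shifted-affine equation for a trajectory with zero past, when the scheduling
trajectory stays close to the present value of an admissible one. -/
theorem zeroPastOutput_shiftedAffine_of_near (sys : StateSpace nu np nx ny)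
    {S : Set (ℤ → Fin np → ℝ)} {P : Set (Fin np → ℝ)} {a : Fin na → AffineMatrix ny ny np}
    {b : Fin nb → AffineMatrix ny nu np}
    (hform : sys.manifestBehavior S = shiftedAffineIOBehavior a b S) {δ : ℝ}
    (hS : ∀ p₁ ∈ S, ∀ p₂ ∈ S, ∀ τ : ℕ, ∀ q ∈ valuedIn P,
      (∀ k : ℤ, k ≤ 0 → q k = p₁ k) → (∀ k : ℤ, (τ : ℤ) ≤ k → q k = p₂ (k - τ)) →
      (∀ k : ℤ, 0 ≤ k → k < τ → ‖WithLp.toLp 2 (q (k + 1) - q k)‖ ≤ δ) → q ∈ S)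
    {p₁ : ℤ → Fin np → ℝ} (hp₁ : p₁ ∈ S) (hp₁P : p₁ ∈ valuedIn P) {p : ℤ → Fin np → ℝ}
    (hp : p ∈ valuedIn P) (hδ : 0 ≤ δ) (hnear : ∀ k, ‖WithLp.toLp 2 (p k - p₁ 0)‖ ≤ δ / 2)
    {u : ℤ → Fin nu → ℝ} (hu : ∀ k ≤ 0, u k = 0) (k : ℤ) :
    sys.zeroPastOutput p u k + ∑ i : Fin na, (a i).eval (p (k - ((i : ℕ) + 1))) *ᵥ
        sys.zeroPastOutput p u (k - ((i : ℕ) + 1))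
      = ∑ i : Fin nb, (b i).eval (p (k - ((i : ℕ) + 1))) *ᵥ u (k - ((i : ℕ) + 1)) := by
  -- Beyond time `k` the scheduling `p` is irrelevant, so it is replaced by the delayed `p₁`
  -- starting from `p₁ 0`. Between the two copies of `p₁` all values lie within `δ / 2` of `p₁ 0`,
  -- which makes `q` admissible.
  obtain ⟨q, hq⟩ : ∃ q : ℤ → Fin np → ℝ, q = fun j => if j ≤ 0 then p₁ j else
    if j ≤ k.toNat then p j else p₁ (j - (k.toNat + 1 : ℕ)) := ⟨_, rfl⟩
  have hq₁ : ∀ j : ℤ, j ≤ 0 → q j = p₁ j := fun j hj => by rw [hq]; simp only [hj, if_true]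
  have hqp : ∀ j : ℤ, 1 ≤ j → j ≤ k → q j = p j := fun j hj hj' => by
    have h1 : ¬ j ≤ 0 := by omega
    have h2 : j ≤ k.toNat := by omega
    rw [hq]; simp only [h1, h2, if_true, if_false]
  have hq₂ : ∀ j : ℤ, ((k.toNat + 1 : ℕ) : ℤ) ≤ j → q j = p₁ (j - (k.toNat + 1 : ℕ)) :=
    fun j hj => by
      have h1 : ¬ j ≤ 0 := by omega
      have h2 : ¬ j ≤ k.toNat := by omega
      rw [hq]; simp only [h1, h2, if_false]
  have hqclose : ∀ j : ℤ, 0 ≤ j → j ≤ (k.toNat + 1 : ℕ) →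
      ‖WithLp.toLp 2 (q j - p₁ 0)‖ ≤ δ / 2 := by
    intro j hj hj'
    have hδ2 : 0 ≤ δ / 2 := by linarith
    rcases hj.eq_or_lt with rfl | hj
    · rw [hq₁ _ le_rfl]; simpa using hδ2
    rcases hj'.eq_or_lt with rfl | hj'
    · rw [hq₂ _ le_rfl]; simpa using hδ2
    · rw [hqp j (by omega) (by omega)]; exact hnear j
  have hqP : q ∈ valuedIn P := by
    intro j
    rcases le_or_gt j 0 with h | h
    · rw [hq₁ j h]; exact hp₁P j
    rcases le_or_gt j k with h' | h'
    · rw [hqp j h h']; exact hp j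
    · rw [hq₂ j (by omega)]; exact hp₁P _
  have hqS : q ∈ S := hS p₁ hp₁ p₁ hp₁ (k.toNat + 1) q hqP hq₁ hq₂ fun j hj hj' => by
    have : q (j + 1) - q j = (q (j + 1) - p₁ 0) - (q j - p₁ 0) := by abel
    rw [this, WithLp.toLp_sub]
    refine (norm_sub_le _ _).trans ?_
    linarith [hqclose j hj hj'.le, hqclose (j + 1) (by omega) (by omega)]
  have hmem : (fun j => (u j, q j, sys.zeroPastOutput q u j)) ∈ shiftedAffineIOBehavior a b S := by
    rw [← hform]
    exact ⟨fun j => (u j, q j, sys.zeroPastState q u j, sys.zeroPastOutput q u j),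
      ⟨hqS, fun j => ⟨sys.zeroPastState_succ q hu j, rfl⟩⟩, rfl⟩
  have hy : ∀ j ≤ k, sys.zeroPastOutput q u j = sys.zeroPastOutput p u j := fun j hj =>
    sys.zeroPastOutput_congr (fun i h h' => hqp i h (by omega)) (fun _ _ _ => rfl) hu hu
  have hk := hmem.2 k
  simp only at hk
  rw [hy k le_rfl] at hk
  convert hk using 2
  · refine Finset.sum_congr rfl fun i _ => ?_
    rw [hy _ (by omega)]
    -- At nonpositive times `q` and `p` may differ, but there the coefficient multiplies zero data.
    rcases le_or_gt (k - ((i : ℕ) + 1)) 0 with h | h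
    · rw [sys.zeroPastOutput_of_le p hu h]; simp
    · rw [hqp _ h (by omega)]
  · rename_i i _
    rcases le_or_gt (k - ((i : ℕ) + 1)) 0 with h | h
    · rw [hu _ h]; simp
    · rw [hqp _ h (by omega)]

/-- A shifted-affine form that is valid along admissible scheduling trajectories is valid for the
zero-past response along every scheduling trajectory with values in `P`. -/
theorem zeroPastOutput_shiftedAffine (sys : StateSpace nu np nx ny)
    {S : Set (ℤ → Fin np → ℝ)} {P : Set (Fin np → ℝ)} (hPcompact : IsCompact P)
    (hPconvex : Convex ℝ P) (hSP : S ⊆ valuedIn P) (hS : AdmitsSlowTransitions P S)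
    (hSne : S.Nonempty) {a : Fin na → AffineMatrix ny ny np} {b : Fin nb → AffineMatrix ny nu np}
    (hform : sys.manifestBehavior S = shiftedAffineIOBehavior a b S)
    {p : ℤ → Fin np → ℝ} (hp : p ∈ valuedIn P) {u : ℤ → Fin nu → ℝ} (hu : ∀ k ≤ 0, u k = 0)
    (k : ℤ) :
    sys.zeroPastOutput p u k + ∑ i : Fin na, (a i).eval (p (k - ((i : ℕ) + 1))) *ᵥ
        sys.zeroPastOutput p u (k - ((i : ℕ) + 1))
      = ∑ i : Fin nb, (b i).eval (p (k - ((i : ℕ) + 1))) *ᵥ u (k - ((i : ℕ) + 1)) := by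
  obtain ⟨p₁, hp₁⟩ := hSne
  obtain ⟨δ, hδ, hS⟩ := hS
  obtain ⟨R, hR0, hR⟩ := exists_norm_toLp_le hPcompact
  have hp₁P := hSP hp₁
  ext r
  rw [← sub_eq_zero]
  let v := p₁ 0
  let f : ℝ → ℝ := fun t =>
    (sys.zeroPastOutput (fun k => v + t • (p k - v)) u k + ∑ i : Fin na,
        (a i).eval (v + t • (p (k - ((i : ℕ) + 1)) - v)) *ᵥ
          sys.zeroPastOutput (fun k => v + t • (p k - v)) u (k - ((i : ℕ) + 1))) r -
      (∑ i : Fin nb, (b i).eval (v + t • (p (k - ((i : ℕ) + 1)) - v)) *ᵥ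
        u (k - ((i : ℕ) + 1))) r
  have hf : ∀ t, AnalyticAt ℝ f t := by
    intro t
    simp only [f, Pi.add_apply, Finset.sum_apply]
    refine ((sys.analyticAt_zeroPastOutput_segment v p u k t r).add
      (Finset.analyticAt_fun_sum _ fun i _ => analyticAt_mulVec
        (fun l j => (a i).analyticAt_eval_segment v _ l j t)
        (fun j => sys.analyticAt_zeroPastOutput_segment v p u _ t j) r)).sub
      (Finset.analyticAt_fun_sum _ fun i _ => ?_)
    exact analyticAt_mulVec (x := fun _ => u (k - ((i : ℕ) + 1)))
        (fun l j => (b i).analyticAt_eval_segment v (p (k - ((i : ℕ) + 1))) l j t)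
        (fun j => analyticAt_const) r
  -- The bound 1 keeps the segment in `P`; the other bound keeps it within `δ / 2` of `v`, since two
  -- points of `P` are at most `2 * R` apart. The value at `t = 1` is the claim for `p`.
  have hzero := eq_zero_of_analytic_of_eq_zero_Ioc hf (ε := min 1 (δ / 2 / (2 * R)))
    (by positivity) (fun t ht0 ht1 => ?_) 1
  · simpa [f] using hzero
  · refine sub_eq_zero.mpr (congrFun ?_ r)
    refine sys.zeroPastOutput_shiftedAffine_of_near (p := fun k => v + t • (p k - v)) hform hS hp₁
      hp₁P (fun j => ?_) hδ.le (fun j => ?_) hu k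
    · exact hPconvex.add_smul_sub_mem (hp₁P 0) (hp j) ⟨ht0.le, ht1.trans (min_le_left _ _)⟩
    · have h1 : ‖WithLp.toLp 2 (p j - v)‖ ≤ 2 * R := by
        rw [WithLp.toLp_sub]
        exact (norm_sub_le _ _).trans (by linarith [hR _ (hp j), hR _ (hp₁P 0)])
      have h2 : t * (2 * R) ≤ δ / 2 := by
        rw [← le_div_iff₀ (by positivity)]
        exact ht1.trans (min_le_right _ _)
      rw [add_sub_cancel_left, WithLp.toLp_smul, norm_smul, Real.norm_of_nonneg ht0.le]
      exact (mul_le_mul_of_nonneg_left h1 ht0.le).trans h2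

end StateSpace

/-! ### The state of the shifted-affine form. -/

/-- The coefficient at lag `i + 1`, extended by zero. -/
noncomputable def lagCoeff {m n np na : ℕ} (a : Fin na → AffineMatrix m n np) (i : ℕ)
    (p : Fin np → ℝ) : Matrix (Fin m) (Fin n) ℝ :=
  if h : i < na then (a ⟨i, h⟩).eval p else 0

theorem continuous_lagCoeff {m n np na : ℕ} (a : Fin na → AffineMatrix m n np) (i : ℕ) :
    Continuous (lagCoeff a i) := by
  by_cases h : i < na
  · have : lagCoeff a i = (a ⟨i, h⟩).eval := by ext1 p; simp [lagCoeff, h]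
    rw [this]
    exact AffineMatrix.continuous_eval _
  · have : lagCoeff a i = fun _ => 0 := by ext1 p; simp [lagCoeff, h]
    rw [this]
    exact continuous_const

theorem lagCoeff_of_le {m n np na : ℕ} (a : Fin na → AffineMatrix m n np) {i : ℕ} (hi : na ≤ i)
    (p : Fin np → ℝ) : lagCoeff a i p = 0 := by
  simp [lagCoeff, hi.not_gt]

theorem sum_eval_mulVec_eq_sum_lagCoeff {m n np na N : ℕ} (hN : na ≤ N)
    (a : Fin na → AffineMatrix m n np) (p : ℤ → Fin np → ℝ) (f : ℤ → Fin n → ℝ) (k : ℤ) :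
    ∑ i : Fin na, (a i).eval (p (k - ((i : ℕ) + 1))) *ᵥ f (k - ((i : ℕ) + 1)) =
      ∑ i ∈ Finset.Ico 0 N, lagCoeff a i (p (k - (i + 1))) *ᵥ f (k - (i + 1)) := by
  rw [← Finset.range_eq_Ico, ← Finset.sum_subset (Finset.range_mono hN), Finset.sum_range]
  · refine Finset.sum_congr rfl fun i _ => ?_
    simp [lagCoeff]
  · intro i _ hi
    rw [lagCoeff_of_le a (by simpa using hi), Matrix.zero_mulVec]

/-- The contribution of the input-output data before time `k` to the output at time `k + i`. -/
noncomputable def pastContribution {nu np ny na nb : ℕ} (a : Fin na → AffineMatrix ny ny np)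
    (b : Fin nb → AffineMatrix ny nu np) (p : ℤ → Fin np → ℝ) (u : ℤ → Fin nu → ℝ)
    (y : ℤ → Fin ny → ℝ) (k : ℤ) (i : ℕ) : Fin ny → ℝ :=
  ∑ j ∈ Finset.Ico i (na + nb), (lagCoeff b j (p (k + i - (j + 1))) *ᵥ u (k + i - (j + 1)) -
    lagCoeff a j (p (k + i - (j + 1))) *ᵥ y (k + i - (j + 1)))

section pastContribution

variable {nu np ny na nb : ℕ} (a : Fin na → AffineMatrix ny ny np)
  (b : Fin nb → AffineMatrix ny nu np)

theorem pastContribution_of_le (p : ℤ → Fin np → ℝ) (u : ℤ → Fin nu → ℝ) (y : ℤ → Fin ny → ℝ)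
    (k : ℤ) {i : ℕ} (hi : na + nb ≤ i) : pastContribution a b p u y k i = 0 := by
  rw [pastContribution, Finset.Ico_eq_empty_of_le hi, Finset.sum_empty]

theorem pastContribution_congr {p p' : ℤ → Fin np → ℝ} {u u' : ℤ → Fin nu → ℝ}
    {y y' : ℤ → Fin ny → ℝ} {k : ℤ} (hp : ∀ j < k, p j = p' j) (hu : ∀ j < k, u j = u' j)
    (hy : ∀ j < k, y j = y' j) (i : ℕ) :
    pastContribution a b p u y k i = pastContribution a b p' u' y' k i := by
  refine Finset.sum_congr rfl fun j hj => ?_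
  rw [Finset.mem_Ico] at hj
  have : k + i - (j + 1) < k := by omega
  rw [hp _ this, hu _ this, hy _ this]

/-- Moving the present from `k` to `k + 1` turns the data at time `k` into past data; at time `k + 1
+ i` they enter with lag `i + 1`. -/
theorem pastContribution_succ (p : ℤ → Fin np → ℝ) (u : ℤ → Fin nu → ℝ) (y : ℤ → Fin ny → ℝ)
    (k : ℤ) (i : ℕ) :
    pastContribution a b p u y (k + 1) i =
      pastContribution a b p u y k (i + 1) + (lagCoeff b i (p k) *ᵥ u k -
        lagCoeff a i (p k) *ᵥ y k) := by
  rcases le_or_gt (na + nb) i with hi | hi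
  · rw [pastContribution_of_le _ _ _ _ _ _ hi, pastContribution_of_le _ _ _ _ _ _ (by omega),
      lagCoeff_of_le a (by omega), lagCoeff_of_le b (by omega)]
    simp
  · rw [pastContribution, Finset.sum_eq_sum_Ico_succ_bot hi, add_comm]
    have h : ∀ j : ℕ, k + 1 + i - ((j : ℤ) + 1) = k + (i + 1 : ℕ) - (j + 1) := fun j => by
      push_cast; ring
    have h' : k + (i + 1 : ℕ) - ((i : ℤ) + 1) = k := by push_cast; ring
    simp only [h, h', pastContribution]

theorem eq_pastContribution_zero {p : ℤ → Fin np → ℝ} {u : ℤ → Fin nu → ℝ} {y : ℤ → Fin ny → ℝ}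
    {k : ℤ} (h : y k + ∑ i : Fin na, (a i).eval (p (k - ((i : ℕ) + 1))) *ᵥ y (k - ((i : ℕ) + 1))
      = ∑ i : Fin nb, (b i).eval (p (k - ((i : ℕ) + 1))) *ᵥ u (k - ((i : ℕ) + 1))) :
    y k = pastContribution a b p u y k 0 := by
  rw [sum_eval_mulVec_eq_sum_lagCoeff (Nat.le_add_right na nb),
    sum_eval_mulVec_eq_sum_lagCoeff (Nat.le_add_left nb na)] at h
  rw [eq_sub_of_add_eq h, ← Finset.sum_sub_distrib, pastContribution]
  simp

end pastContribution

/-! ### The scheduling-independent map from `x` to the state of the shifted-affine form. -/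

namespace StateSpace

variable {nu np nx ny na nb : ℕ}

/-- The block rows of the transformation to the state of the shifted-affine form, computed along
the constant scheduling trajectory `v`. -/
noncomputable def observerRow (sys : StateSpace nu np nx ny) (a : Fin na → AffineMatrix ny ny np)
    (v : Fin np → ℝ) : ℕ → Matrix (Fin ny) (Fin nx) ℝ
  | 0 => sys.C.eval v
  | i + 1 => sys.observerRow a v i * sys.A.eval v + lagCoeff a i v * sys.C.eval v

/-- The shifted-affine equations hold along all trajectories with zero past and `P`-valued
scheduling. -/
def SatisfiesShiftedAffine (sys : StateSpace nu np nx ny) (P : Set (Fin np → ℝ))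
    (a : Fin na → AffineMatrix ny ny np) (b : Fin nb → AffineMatrix ny nu np) : Prop :=
  ∀ p ∈ valuedIn P, ∀ u : ℤ → Fin nu → ℝ, (∀ k ≤ 0, u k = 0) → ∀ k : ℤ,
    sys.zeroPastOutput p u k + ∑ i : Fin na, (a i).eval (p (k - ((i : ℕ) + 1))) *ᵥ
        sys.zeroPastOutput p u (k - ((i : ℕ) + 1))
      = ∑ i : Fin nb, (b i).eval (p (k - ((i : ℕ) + 1))) *ᵥ u (k - ((i : ℕ) + 1))

/-- Both sides depend only on data before `k`, whereas `observerRow` is computed from the frozen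
future; hence one matrix serves for all scheduling trajectories. -/
theorem SatisfiesShiftedAffine.pastContribution_eq {sys : StateSpace nu np nx ny}
    {P : Set (Fin np → ℝ)} {a : Fin na → AffineMatrix ny ny np}
    {b : Fin nb → AffineMatrix ny nu np} (h : sys.SatisfiesShiftedAffine P a b)
    {v : Fin np → ℝ} (hv : v ∈ P) {p : ℤ → Fin np → ℝ} (hp : p ∈ valuedIn P)
    {u : ℤ → Fin nu → ℝ} (hu : ∀ k ≤ 0, u k = 0) {k : ℤ} (hk : 1 ≤ k) (i : ℕ) :
    pastContribution a b p u (sys.zeroPastOutput p u) k i =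
      sys.observerRow a v i *ᵥ sys.zeroPastState p u k := by
  -- Case of constant scheduling `v` and zero input from `k` on: `pastContribution_succ`, solved for
  -- index `i + 1`, is the recursion defining `observerRow`.
  have key : ∀ (p : ℤ → Fin np → ℝ), p ∈ valuedIn P → ∀ u : ℤ → Fin nu → ℝ,
      (∀ k ≤ 0, u k = 0) → ∀ k : ℤ, (∀ j, k ≤ j → p j = v) → (∀ j, k ≤ j → u j = 0) →
      pastContribution a b p u (sys.zeroPastOutput p u) k i =
        sys.observerRow a v i *ᵥ sys.zeroPastState p u k := by
    intro p hp u hu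
    induction i with
    | zero =>
      intro k hpk huk
      rw [← eq_pastContribution_zero a b (h p hp u hu k), zeroPastOutput, hpk k le_rfl,
        huk k le_rfl, Matrix.mulVec_zero, add_zero, observerRow]
    | succ i ih =>
      intro k hpk huk
      have hrec := pastContribution_succ a b p u (sys.zeroPastOutput p u) k i
      rw [ih (k + 1) (fun j hj => hpk j (by omega)) (fun j hj => huk j (by omega)),
        huk k le_rfl, Matrix.mulVec_zero, zero_sub, ← sub_eq_add_neg, eq_sub_iff_add_eq] at hrec
      rw [← hrec, sys.zeroPastState_succ p hu, zeroPastOutput, hpk k le_rfl, huk k le_rfl,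
        observerRow, Matrix.add_mulVec, Matrix.mulVec_zero, Matrix.mulVec_zero, add_zero,
        add_zero, Matrix.mulVec_mulVec, Matrix.mulVec_mulVec]
  obtain ⟨p', hp'⟩ : ∃ p' : ℤ → Fin np → ℝ, p' = fun j => if j < k then p j else v := ⟨_, rfl⟩
  obtain ⟨u', hu'⟩ : ∃ u' : ℤ → Fin nu → ℝ, u' = fun j => if j < k then u j else 0 := ⟨_, rfl⟩
  have hpp : ∀ j < k, p j = p' j := fun j hj => by rw [hp']; simp only [hj, if_true]
  have huu : ∀ j < k, u j = u' j := fun j hj => by rw [hu']; simp only [hj, if_true]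
  have hu0 : ∀ j ≤ 0, u' j = 0 := fun j hj => by rw [← huu j (by omega), hu j hj]
  rw [pastContribution_congr a b hpp huu (y' := sys.zeroPastOutput p' u') (fun j hj =>
      sys.zeroPastOutput_congr (fun l _ h' => hpp l (by omega)) (fun l _ h' => huu l (by omega))
        hu hu0) i,
    sys.zeroPastState_congr (fun l _ h' => hpp l (by omega)) (fun l _ h' => huu l (by omega))]
  refine key p' (fun j => ?_) u' hu0 k (fun j hj => ?_) (fun j hj => ?_)
  · rw [hp']
    dsimp only
    split_ifs
    exacts [hp j, hv]
  · rw [hp']; simp only [hj.not_gt, if_false]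
  · rw [hu']; simp only [hj.not_gt, if_false]

/-- Every state occurs at some time on a trajectory with zero past, with arbitrary present
scheduling and input. -/
theorem StructurallyControllable.exists_zeroPastState_eq {sys : StateSpace nu np nx ny}
    {P : Set (Fin np → ℝ)} (hctr : sys.StructurallyControllable P) {v : Fin np → ℝ} (hv : v ∈ P)
    (x : Fin nx → ℝ) (w : Fin nu → ℝ) :
    ∃ p ∈ valuedIn P, ∃ u : ℤ → Fin nu → ℝ, (∀ k ≤ 0, u k = 0) ∧ ∃ k : ℤ, 1 ≤ k ∧
      sys.zeroPastState p u k = x ∧ p k = v ∧ u k = w := by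
  obtain ⟨p, hp, hs⟩ := hctr.exists_surjective
  obtain ⟨u, hu⟩ := sys.exists_run_eq hs 0 x
  -- The steering window, shifted by one, occupies times `1, …, nx`. The state `x` is reached at `nx
  -- + 1`, where scheduling and input are still free.
  refine ⟨fun j => if j ≤ nx then p (j - 1) else v, fun j => ?_, fun j => if j ≤ 0 then 0 else
    if j ≤ nx then u (j - 1) else w, fun k hk => by simp [hk], nx + 1, by omega, ?_, by simp, ?_⟩
  · dsimp only
    split_ifs
    exacts [hp _, hv]
  · have : ((nx : ℤ) + 1 - 1).toNat = nx := by omega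
    rw [zeroPastState, this, ← hu]
    refine sys.run_congr _ (fun j hj => ?_) fun j hj => ?_
    · have : (1 : ℤ) + j ≤ nx := by omega
      simp [this]
    · have h1 : ¬ (1 : ℤ) + j ≤ 0 := by omega
      have h2 : (1 : ℤ) + j ≤ nx := by omega
      simp [h1, h2]
  · have h1 : ¬ (nx : ℤ) + 1 ≤ 0 := by omega
    simp [h1]

/-- The output is determined by strictly past data, so on `P` the matrix `C` is constant and `D`
vanishes. -/
theorem SatisfiesShiftedAffine.output_eq {sys : StateSpace nu np nx ny}
    {P : Set (Fin np → ℝ)} {a : Fin na → AffineMatrix ny ny np}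
    {b : Fin nb → AffineMatrix ny nu np} (h : sys.SatisfiesShiftedAffine P a b)
    (hctr : sys.StructurallyControllable P) {v p : Fin np → ℝ} (hv : v ∈ P) (hp : p ∈ P)
    (x : Fin nx → ℝ) (u : Fin nu → ℝ) :
    sys.C.eval p *ᵥ x + sys.D.eval p *ᵥ u = sys.observerRow a v 0 *ᵥ x := by
  obtain ⟨q, hq, w, hw, k, hk, rfl, rfl, rfl⟩ := hctr.exists_zeroPastState_eq hp x u
  rw [← h.pastContribution_eq hv hq hw hk, ← eq_pastContribution_zero a b (h q hq w hw k),
    zeroPastOutput]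

theorem SatisfiesShiftedAffine.observerRow_mulVec_succ {sys : StateSpace nu np nx ny}
    {P : Set (Fin np → ℝ)} {a : Fin na → AffineMatrix ny ny np}
    {b : Fin nb → AffineMatrix ny nu np} (h : sys.SatisfiesShiftedAffine P a b)
    (hctr : sys.StructurallyControllable P) {v p : Fin np → ℝ} (hv : v ∈ P) (hp : p ∈ P)
    (x : Fin nx → ℝ) (u : Fin nu → ℝ) (i : ℕ) :
    sys.observerRow a v i *ᵥ (sys.A.eval p *ᵥ x + sys.B.eval p *ᵥ u) =
      sys.observerRow a v (i + 1) *ᵥ x + (lagCoeff b i p *ᵥ u -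
        lagCoeff a i p *ᵥ (sys.C.eval p *ᵥ x + sys.D.eval p *ᵥ u)) := by
  obtain ⟨q, hq, w, hw, k, hk, rfl, rfl, rfl⟩ := hctr.exists_zeroPastState_eq hp x u
  rw [← h.pastContribution_eq hv hq hw hk, ← sys.zeroPastState_succ q hw,
    ← h.pastContribution_eq hv hq hw (by omega), pastContribution_succ, zeroPastOutput]

theorem SatisfiesShiftedAffine.observerRow_of_le {sys : StateSpace nu np nx ny}
    {P : Set (Fin np → ℝ)} {a : Fin na → AffineMatrix ny ny np}
    {b : Fin nb → AffineMatrix ny nu np} (h : sys.SatisfiesShiftedAffine P a b)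
    (hctr : sys.StructurallyControllable P) {v : Fin np → ℝ} (hv : v ∈ P) {i : ℕ}
    (hi : na + nb ≤ i) (x : Fin nx → ℝ) : sys.observerRow a v i *ᵥ x = 0 := by
  obtain ⟨p, hp, u, hu, k, hk, rfl, -, -⟩ := hctr.exists_zeroPastState_eq hv x 0
  rw [← h.pastContribution_eq hv hp hu hk, pastContribution_of_le _ _ _ _ _ _ hi]

/-- The joint kernel of the rows is invariant under `A(p)` for every `p ∈ P`, and the output
vanishes on it, so it lies in the kernel of every observability matrix. -/
theorem SatisfiesShiftedAffine.eq_zero_of_observerRow {sys : StateSpace nu np nx ny}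
    {P : Set (Fin np → ℝ)} {a : Fin na → AffineMatrix ny ny np}
    {b : Fin nb → AffineMatrix ny nu np} (h : sys.SatisfiesShiftedAffine P a b)
    (hmin : sys.IsMinimal P) {v : Fin np → ℝ} (hv : v ∈ P) {x : Fin nx → ℝ}
    (hx : ∀ i < na + nb, sys.observerRow a v i *ᵥ x = 0) : x = 0 := by
  obtain ⟨p, hp, hobs⟩ := hmin.1.exists_injective
  have hall : ∀ j i : ℕ, sys.observerRow a v i *ᵥ (sys.transition p 0 j *ᵥ x) = 0 := by
    intro j
    induction j with
    | zero =>
      intro i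
      rw [transition, Matrix.one_mulVec]
      rcases lt_or_ge i (na + nb) with hi | hi
      · exact hx i hi
      · exact h.observerRow_of_le hmin.2 hv hi x
    | succ j ih =>
      intro i
      have hy := h.output_eq hmin.2 hv (hp (0 + j)) (sys.transition p 0 j *ᵥ x) 0
      have := h.observerRow_mulVec_succ hmin.2 hv (hp (0 + j)) (sys.transition p 0 j *ᵥ x) 0 i
      rw [hy, ih, ih] at this
      simpa [transition, Matrix.mulVec_mulVec] using this
  refine hobs x fun j => ?_
  have := h.output_eq hmin.2 hv (hp j) (sys.transition p 0 j *ᵥ x) 0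
  rwa [hall, Matrix.mulVec_zero, add_zero] at this

end StateSpace

/-! ### Quadratic estimates and the Gram matrix of a nilpotent shift. -/

theorem normSq_toLp_eq_dotProduct {n : ℕ} (x : Fin n → ℝ) :
    ‖WithLp.toLp 2 x‖ ^ 2 = x ⬝ᵥ x := by
  rw [EuclideanSpace.norm_sq_eq]
  simp [dotProduct, sq]

theorem normSq_toLp_mulVec_le {m n : ℕ} (M : Matrix (Fin m) (Fin n) ℝ) (x : Fin n → ℝ) :
    ‖WithLp.toLp 2 (M *ᵥ x)‖ ^ 2 ≤ (∑ i, ∑ j, M i j ^ 2) * ‖WithLp.toLp 2 x‖ ^ 2 := by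
  simp only [EuclideanSpace.norm_sq_eq, Real.norm_eq_abs, sq_abs, Matrix.mulVec, dotProduct]
  rw [Finset.sum_mul]
  exact Finset.sum_le_sum fun i _ => Finset.sum_mul_sq_le_sq_mul_sq _ _ _

theorem normSq_toLp_add_le {n : ℕ} (x y : Fin n → ℝ) :
    ‖WithLp.toLp 2 (x + y)‖ ^ 2 ≤ 2 * ‖WithLp.toLp 2 x‖ ^ 2 + 2 * ‖WithLp.toLp 2 y‖ ^ 2 := by
  rw [WithLp.toLp_add]
  have := norm_add_le (WithLp.toLp 2 x) (WithLp.toLp 2 y)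
  nlinarith [norm_nonneg (WithLp.toLp 2 x + WithLp.toLp 2 y),
    sq_nonneg (‖WithLp.toLp 2 x‖ - ‖WithLp.toLp 2 y‖)]

theorem exists_normSq_mulVec_le {m n np : ℕ} {P : Set (Fin np → ℝ)} (hP : IsCompact P)
    {M : (Fin np → ℝ) → Matrix (Fin m) (Fin n) ℝ} (hM : Continuous M) :
    ∃ K : ℝ, 0 ≤ K ∧ ∀ p ∈ P, ∀ x, ‖WithLp.toLp 2 (M p *ᵥ x)‖ ^ 2 ≤ K * ‖WithLp.toLp 2 x‖ ^ 2 := by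
  obtain ⟨K, hK⟩ := hP.exists_bound_of_continuousOn (f := fun p => ∑ i, ∑ j, M p i j ^ 2)
    (by fun_prop)
  refine ⟨max K 0, le_max_right _ _, fun p hp x => (normSq_toLp_mulVec_le _ _).trans ?_⟩
  gcongr
  exact (Real.le_norm_self _).trans ((hK p hp).trans (le_max_left _ _))

theorem exists_le_sum_normSq_mulVec {m n N : ℕ} (G : ℕ → Matrix (Fin m) (Fin n) ℝ)
    (hG : ∀ x : Fin n → ℝ, (∀ i < N, G i *ᵥ x = 0) → x = 0) :
    ∃ c : ℝ, 0 < c ∧ ∀ x, c * ‖WithLp.toLp 2 x‖ ^ 2 ≤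
      ∑ i ∈ Finset.range N, ‖WithLp.toLp 2 (G i *ᵥ x)‖ ^ 2 := by
  let L : EuclideanSpace ℝ (Fin n) →ₗ[ℝ] (Fin N → EuclideanSpace ℝ (Fin m)) :=
    LinearMap.pi fun i => (WithLp.linearEquiv 2 ℝ (Fin m → ℝ)).symm.toLinearMap ∘ₗ
      (G i).mulVecLin ∘ₗ (WithLp.linearEquiv 2 ℝ (Fin n → ℝ)).toLinearMap
  have hL : ∀ (x : Fin n → ℝ) i, L (WithLp.toLp 2 x) i = WithLp.toLp 2 (G i *ᵥ x) :=
    fun x i => rfl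
  have hker : LinearMap.ker L = ⊥ := by
    refine LinearMap.ker_eq_bot'.mpr fun x hx => ?_
    have hz := hG x.ofLp fun i hi => by
      have := congrFun hx ⟨i, hi⟩
      have h2 := hL x.ofLp ⟨i, hi⟩
      rw [WithLp.toLp_ofLp, this] at h2
      simpa using h2.symm
    simpa using hz
  obtain ⟨K, hK0, hK⟩ := L.exists_antilipschitzWith hker
  have hKR : (0 : ℝ) < K := hK0
  refine ⟨1 / (K : ℝ) ^ 2, by positivity, fun x => ?_⟩
  have h1 : ‖WithLp.toLp 2 x‖ ≤ K * ‖L (WithLp.toLp 2 x)‖ :=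
    ZeroHomClass.bound_of_antilipschitz L hK _
  have h2 : ‖L (WithLp.toLp 2 x)‖ ≤
      Real.sqrt (∑ i ∈ Finset.range N, ‖WithLp.toLp 2 (G i *ᵥ x)‖ ^ 2) := by
    refine (pi_norm_le_iff_of_nonneg (Real.sqrt_nonneg _)).mpr fun i => Real.le_sqrt_of_sq_le ?_
    rw [hL]
    exact Finset.single_le_sum (f := fun i => ‖WithLp.toLp 2 (G i *ᵥ x)‖ ^ 2)
      (fun _ _ => sq_nonneg _) (Finset.mem_range.mpr i.2)
  have h3 : ‖WithLp.toLp 2 x‖ ^ 2 ≤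
      (K * Real.sqrt (∑ i ∈ Finset.range N, ‖WithLp.toLp 2 (G i *ᵥ x)‖ ^ 2)) ^ 2 := by
    gcongr
    exact h1.trans (by gcongr)
  rw [mul_pow, Real.sq_sqrt (Finset.sum_nonneg fun _ _ => sq_nonneg _)] at h3
  rw [one_div_mul_eq_div, div_le_iff₀ (by positivity), mul_comm]
  exact h3

/-- The weighted Gram matrix of the block rows `G i`, in which the weights decrease along the
shift `i + 1 ↦ i`. -/
noncomputable def shiftGram {m n : ℕ} (G : ℕ → Matrix (Fin m) (Fin n) ℝ) (N : ℕ) (c : ℝ) :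
    Matrix (Fin n) (Fin n) ℝ :=
  ∑ i ∈ Finset.range N, (c * (2 ^ (i + 1) - 1)) • ((G i)ᵀ * G i)

theorem dotProduct_shiftGram_mulVec {m n : ℕ} (G : ℕ → Matrix (Fin m) (Fin n) ℝ) (N : ℕ) (c : ℝ)
    (x : Fin n → ℝ) :
    x ⬝ᵥ (shiftGram G N c *ᵥ x) =
      c * ∑ i ∈ Finset.range N, (2 ^ (i + 1) - 1) * ‖WithLp.toLp 2 (G i *ᵥ x)‖ ^ 2 := by
  rw [shiftGram, Matrix.sum_mulVec, dotProduct_sum, Finset.mul_sum]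
  refine Finset.sum_congr rfl fun i _ => ?_
  rw [Matrix.smul_mulVec, dotProduct_smul, normSq_toLp_eq_dotProduct, ← Matrix.mulVec_mulVec,
    Matrix.dotProduct_mulVec, Matrix.vecMul_transpose, smul_eq_mul, mul_assoc]

theorem isHermitian_shiftGram {m n : ℕ} (G : ℕ → Matrix (Fin m) (Fin n) ℝ) (N : ℕ) (c : ℝ) :
    (shiftGram G N c).IsHermitian := by
  simp [Matrix.IsHermitian, shiftGram, Matrix.conjTranspose_eq_transpose_of_trivial,
    Matrix.transpose_sum]

theorem one_le_two_pow_succ_sub_one (i : ℕ) : (1 : ℝ) ≤ 2 ^ (i + 1) - 1 := by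
  have : (1 : ℝ) ≤ 2 ^ i := one_le_pow₀ one_le_two
  rw [pow_succ]
  linarith

theorem sum_normSq_le_dotProduct_shiftGram {m n : ℕ} (G : ℕ → Matrix (Fin m) (Fin n) ℝ) (N : ℕ)
    {c : ℝ} (hc : 0 ≤ c) (x : Fin n → ℝ) :
    c * ∑ i ∈ Finset.range N, ‖WithLp.toLp 2 (G i *ᵥ x)‖ ^ 2 ≤ x ⬝ᵥ (shiftGram G N c *ᵥ x) := by
  rw [dotProduct_shiftGram_mulVec]
  gcongr with i
  exact le_mul_of_one_le_left (sq_nonneg _) (one_le_two_pow_succ_sub_one i)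

/-- Dissipation inequality for a perturbed shift of the block rows. -/
theorem dotProduct_shiftGram_step_le {m n N : ℕ} {G : ℕ → Matrix (Fin m) (Fin n) ℝ} {c : ℝ}
    (hc : 0 ≤ c) {x x' : Fin n → ℝ} {e : ℕ → Fin m → ℝ}
    (hstep : ∀ i, G i *ᵥ x' = G (i + 1) *ᵥ x + e i) (hN : G N *ᵥ x = 0) :
    x' ⬝ᵥ (shiftGram G N c *ᵥ x') - x ⬝ᵥ (shiftGram G N c *ᵥ x) ≤
      -(c * ∑ i ∈ Finset.range N, ‖WithLp.toLp 2 (G i *ᵥ x)‖ ^ 2) +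
        c * ∑ i ∈ Finset.range N, (2 ^ (i + 1) - 1) * (2 * ‖WithLp.toLp 2 (e i)‖ ^ 2) := by
  rw [dotProduct_shiftGram_mulVec, dotProduct_shiftGram_mulVec, ← mul_sub, ← mul_neg, ← mul_add]
  refine mul_le_mul_of_nonneg_left ?_ hc
  let s : ℕ → ℝ := fun i => ‖WithLp.toLp 2 (G i *ᵥ x)‖ ^ 2
  have h1 : ∑ i ∈ Finset.range N, (2 ^ (i + 1) - 1) * ‖WithLp.toLp 2 (G i *ᵥ x')‖ ^ 2 ≤
      ∑ i ∈ Finset.range N, (2 ^ (i + 1 + 1) - 2) * s (i + 1) +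
        ∑ i ∈ Finset.range N, (2 ^ (i + 1) - 1) * (2 * ‖WithLp.toLp 2 (e i)‖ ^ 2) := by
    rw [← Finset.sum_add_distrib]
    refine Finset.sum_le_sum fun i _ => ?_
    have h := normSq_toLp_add_le (G (i + 1) *ᵥ x) (e i)
    rw [← hstep] at h
    refine (mul_le_mul_of_nonneg_left h
      (zero_le_one.trans (one_le_two_pow_succ_sub_one i))).trans_eq ?_
    simp only [s]
    ring
  -- Both boundary terms vanish: the weight is 0 at `i = 0`, and `s N = 0` by `hN`. The weights `w i
  -- = 2 ^ (i + 1) - 1` satisfy `2 * w i = w (i + 1) - 1`, which absorbs the factor 2 of the squared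
  -- triangle inequality and leaves a decrease of one `s i` each.
  have h2 : ∑ i ∈ Finset.range N, (2 ^ (i + 1 + 1) - 2) * s (i + 1) =
      ∑ i ∈ Finset.range N, (2 ^ (i + 1) - 2) * s i := by
    have := (Finset.sum_range_succ' (fun i => ((2 : ℝ) ^ (i + 1) - 2) * s i) N).symm.trans
      (Finset.sum_range_succ (fun i => ((2 : ℝ) ^ (i + 1) - 2) * s i) N)
    simpa [s, hN] using this
  have h3 : ∑ i ∈ Finset.range N, (2 ^ (i + 1) - 2) * s i =
      ∑ i ∈ Finset.range N, (2 ^ (i + 1) - 1) * s i - ∑ i ∈ Finset.range N, s i := by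
    rw [← Finset.sum_sub_distrib]
    exact Finset.sum_congr rfl fun i _ => by ring
  rw [h2, h3] at h1
  linarith

end LPV

/-! ### Assembly of the two claims. -/

theorem lemma1 {nu np nx ny : ℕ} (sys : LPV.StateSpace nu np nx ny)
    (P : Set (Fin np → ℝ)) (hPcompact : IsCompact P) (hPconvex : Convex ℝ P)
    (S : Set (ℤ → Fin np → ℝ)) (hSP : S ⊆ LPV.valuedIn P)
    (hS : LPV.AdmitsSlowTransitions P S)
    (hmin : sys.IsMinimal P)
    (hform : LPV.AdmitsShiftedAffineForm sys S) :
    LPV.IsControllable (sys.behavior S) ∧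
    ∃ Pmat : (Fin np → ℝ) → Matrix (Fin nx) (Fin nx) ℝ,
      (∀ p ∈ P, (Pmat p).PosDef) ∧
      (∃ α₁ α₂ : ℝ, 0 < α₁ ∧ 0 < α₂ ∧ ∀ p ∈ P, ∀ x : Fin nx → ℝ,
        α₁ * ‖WithLp.toLp 2 x‖ ^ 2 ≤ LPV.quadForm Pmat x p ∧
        LPV.quadForm Pmat x p ≤ α₂ * ‖WithLp.toLp 2 x‖ ^ 2) ∧
      ∃ c₁ c₂ : ℝ, 0 < c₁ ∧ 0 < c₂ ∧
        ∀ (u : ℤ → Fin nu → ℝ) (p : ℤ → Fin np → ℝ) (x : ℤ → Fin nx → ℝ) (y : ℤ → Fin ny → ℝ),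
          (fun k => (u k, p k, x k, y k)) ∈ sys.behavior S →
          ∀ k : ℤ,
            LPV.quadForm Pmat (x (k + 1)) (p (k + 1)) - LPV.quadForm Pmat (x k) (p k)
              ≤ -(1 / 2) * ‖WithLp.toLp 2 (x k)‖ ^ 2 + c₁ * ‖WithLp.toLp 2 (u k)‖ ^ 2
                + c₂ * ‖WithLp.toLp 2 (y k)‖ ^ 2 := by
  refine ⟨sys.isControllable_behavior hPcompact hPconvex hSP hS hmin.2, ?_⟩
  -- Without admissible trajectories the dissipation inequality is vacuous; otherwise one of them
  -- supplies the base point `v` of the rows.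
  rcases S.eq_empty_or_nonempty with rfl | hSne
  · refine ⟨fun _ => 1, fun _ _ => Matrix.PosDef.one,
      ⟨1, 1, one_pos, one_pos, fun p _ x => ?_⟩, 1, 1, one_pos, one_pos,
      fun u p x y h => absurd h.1 (Set.notMem_empty _)⟩
    simp [LPV.quadForm, LPV.normSq_toLp_eq_dotProduct]
  obtain ⟨na, nb, -, -, a, b, hform⟩ := hform
  have hsat : sys.SatisfiesShiftedAffine P a b := fun p hp u hu k =>
    sys.zeroPastOutput_shiftedAffine hPcompact hPconvex hSP hS hSne hform hp hu k
  obtain ⟨p₀, hp₀⟩ := hSne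
  have hv : p₀ 0 ∈ P := hSP hp₀ 0
  let G := sys.observerRow a (p₀ 0)
  let N := na + nb
  obtain ⟨c, hc, hlow⟩ := LPV.exists_le_sum_normSq_mulVec (N := N) G
    fun x hx => hsat.eq_zero_of_observerRow hmin hv hx
  choose Ka hKa0 hKa using fun i =>
    LPV.exists_normSq_mulVec_le hPcompact (LPV.continuous_lagCoeff a i)
  choose Kb hKb0 hKb using fun i =>
    LPV.exists_normSq_mulVec_le hPcompact (LPV.continuous_lagCoeff b i)
  -- Scaled so that the decrease `r * ∑ ‖G i x‖ ^ 2` is at least `1 / 2 * ‖x‖ ^ 2`.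
  let r := 1 / (2 * c)
  have hr : 0 < r := by positivity
  have hlow' : ∀ x : Fin nx → ℝ, 1 / 2 * ‖WithLp.toLp 2 x‖ ^ 2 ≤
      r * ∑ i ∈ Finset.range N, ‖WithLp.toLp 2 (G i *ᵥ x)‖ ^ 2 := fun x => by
    refine le_trans (le_of_eq ?_) (mul_le_mul_of_nonneg_left (hlow x) hr.le)
    simp only [r]
    field_simp
  have hlower : ∀ x : Fin nx → ℝ, 1 / 2 * ‖WithLp.toLp 2 x‖ ^ 2 ≤
      x ⬝ᵥ (LPV.shiftGram G N r *ᵥ x) := fun x =>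
    (hlow' x).trans (LPV.sum_normSq_le_dotProduct_shiftGram G N hr.le x)
  have hw : ∀ i : ℕ, (0 : ℝ) ≤ 2 ^ (i + 1) - 1 := fun i =>
    zero_le_one.trans (LPV.one_le_two_pow_succ_sub_one i)
  -- The Lyapunov matrix is constant in `p`. The factors 4 come from two squared triangle
  -- inequalities, one in the shift and one separating `u` from `y`; each `+ 1` only ensures
  -- positivity.
  refine ⟨fun _ => LPV.shiftGram G N r, fun p _ => ?_,
    ⟨1 / 2, r * ∑ i ∈ Finset.range N, (2 ^ (i + 1) - 1) * (∑ l, ∑ j, G i l j ^ 2) + 1,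
      by norm_num, ?_, fun p _ x => ⟨hlower x, ?_⟩⟩,
    r * ∑ i ∈ Finset.range N, (2 ^ (i + 1) - 1) * (4 * Kb i) + 1,
    r * ∑ i ∈ Finset.range N, (2 ^ (i + 1) - 1) * (4 * Ka i) + 1, ?_, ?_, ?_⟩
  · refine Matrix.PosDef.of_dotProduct_mulVec_pos (LPV.isHermitian_shiftGram G N r) fun x hx => ?_
    have hx' : 0 < ‖WithLp.toLp 2 x‖ := norm_pos_iff.mpr (by simpa using hx)
    have : 0 < 1 / 2 * ‖WithLp.toLp 2 x‖ ^ 2 := by positivity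
    simpa using this.trans_le (hlower x)
  · have : 0 ≤ ∑ i ∈ Finset.range N, ((2 : ℝ) ^ (i + 1) - 1) * (∑ l, ∑ j, G i l j ^ 2) :=
      Finset.sum_nonneg fun i _ => mul_nonneg (hw i) (by positivity)
    positivity
  · rw [LPV.quadForm, LPV.dotProduct_shiftGram_mulVec, add_mul, mul_assoc, Finset.sum_mul]
    refine le_add_of_le_of_nonneg (mul_le_mul_of_nonneg_left
      (Finset.sum_le_sum fun i _ => ?_) hr.le) (by positivity)
    rw [mul_assoc]
    exact mul_le_mul_of_nonneg_left (LPV.normSq_toLp_mulVec_le _ _) (hw i)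
  · have : 0 ≤ ∑ i ∈ Finset.range N, ((2 : ℝ) ^ (i + 1) - 1) * (4 * Kb i) :=
      Finset.sum_nonneg fun i _ => mul_nonneg (hw i) (mul_nonneg (by norm_num) (hKb0 i))
    positivity
  · have : 0 ≤ ∑ i ∈ Finset.range N, ((2 : ℝ) ^ (i + 1) - 1) * (4 * Ka i) :=
      Finset.sum_nonneg fun i _ => mul_nonneg (hw i) (mul_nonneg (by norm_num) (hKa0 i))
    positivity
  · intro u p x y hmem k
    have hpk : p k ∈ P := hSP hmem.1 k
    have hstate : x (k + 1) = sys.A.eval (p k) *ᵥ x k + sys.B.eval (p k) *ᵥ u k := (hmem.2 k).1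
    have hout : y k = sys.C.eval (p k) *ᵥ x k + sys.D.eval (p k) *ᵥ u k := (hmem.2 k).2
    have hmain := LPV.dotProduct_shiftGram_step_le (G := G) (N := N) hr.le (x := x k)
      (x' := x (k + 1))
      (e := fun i => LPV.lagCoeff b i (p k) *ᵥ u k + -(LPV.lagCoeff a i (p k) *ᵥ y k))
      (fun i => by
        rw [hstate, hout, ← sub_eq_add_neg]
        exact hsat.observerRow_mulVec_succ hmin.2 hv hpk (x k) (u k) i)
      (hsat.observerRow_of_le hmin.2 hv le_rfl (x k))
    have herr : ∑ i ∈ Finset.range N, ((2 : ℝ) ^ (i + 1) - 1) * (2 * ‖WithLp.toLp 2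
        (LPV.lagCoeff b i (p k) *ᵥ u k + -(LPV.lagCoeff a i (p k) *ᵥ y k))‖ ^ 2) ≤
        (∑ i ∈ Finset.range N, (2 ^ (i + 1) - 1) * (4 * Kb i)) * ‖WithLp.toLp 2 (u k)‖ ^ 2 +
        (∑ i ∈ Finset.range N, (2 ^ (i + 1) - 1) * (4 * Ka i)) * ‖WithLp.toLp 2 (y k)‖ ^ 2 := by
      rw [Finset.sum_mul, Finset.sum_mul, ← Finset.sum_add_distrib]
      refine Finset.sum_le_sum fun i _ => ?_
      rw [mul_assoc _ (4 * Kb i), mul_assoc _ (4 * Ka i), ← mul_add]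
      refine mul_le_mul_of_nonneg_left ?_ (hw i)
      have h := LPV.normSq_toLp_add_le (LPV.lagCoeff b i (p k) *ᵥ u k)
        (-(LPV.lagCoeff a i (p k) *ᵥ y k))
      rw [WithLp.toLp_neg, norm_neg] at h
      linarith [hKa i (p k) hpk (y k), hKb i (p k) hpk (u k)]
    have herr' := mul_le_mul_of_nonneg_left herr hr.le
    rw [mul_add, ← mul_assoc, ← mul_assoc] at herr'
    simp only [LPV.quadForm]
    linarith [hlow' (x k), sq_nonneg ‖WithLp.toLp 2 (u k)‖, sq_nonneg ‖WithLp.toLp 2 (y k)‖]
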